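/- Let $\mathcal{H}$ be a complex Hilbert space and let $f:\mathbb{R}\to\mathbb{R}$ be continuous. For a (possibly unbounded) self-adjoint operator $H$ on $\mathcal{H}$ with spectral measure $E$, so that $H=\int\lambda\,dE(\lambda)$, let $f(H)=\int f\,dE$ on its natural domain $\{\psi:\int|f|^2\,d\langle\psi,E\psi\rangle<\infty\}$. Let $P^{\mathrm{ac}}(H)$ be the orthogonal projection onto the subspace of all $\psi$ for which the measure $\langle\psi,E(\cdot)\psi\rangle$ is absolutely continuous with respect to Lebesgue measure; $H$ has purely absolutely continuous spectrum if $P^{\mathrm{ac}}(H)=\mathbf{1}$. For self-adjoint $H,K$ on $\mathcal{H}$ let $$W_\pm(K,H)=\operatorname*{s-lim}_{t\to\pm\infty}e^{-itK}e^{itH}P^{\mathrm{ac}}(H)$$ if these strong limits exist. The pair $(K,H)$ is called $f$-bounded if both $W_+(K,H)$ and $W_-(K,H)$ exist and both operators $\big(W_\pm(K,H)-P^{\mathrm{ac}}(K)P^{\mathrm{ac}}(H)\big)f(H)$ are bounded on the domain of $f(H)$. Write $K\sim_f H$ if both $(K,H)$ and $(H,K)$ are $f$-bounded. (a) Let $H_0,H_1,H_2$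 be self-adjoint operators on $\mathcal{H}$ with $H_0\sim_f H_1$ and $H_1\sim_f H_2$, such that $\big(\mathbf{1}-P^{\mathrm{ac}}(H_1)\big)f(H_0)$ and $\big(\mathbf{1}-P^{\mathrm{ac}}(H_1)\big)f(H_2)$ are bounded on the domains of $f(H_0)$ and $f(H_2)$, respectively. Then $H_0\sim_f H_2$. (b) $\sim_f$ is an equivalence relation on the set of all self-adjoint operators on $\mathcal{H}$ with purely absolutely continuous spectrum. -/

import Mathlib

open MeasureTheory Filter Topology
open scoped ENNReal

namespace Scattering

universe u

/-- A projection-valued measure (resolution of the identity) on the Borel sets of `ℝ`, acting on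
the Hilbert space `𝓗`. Non-measurable sets are sent to `0`. -/
structure PVM (𝓗 : Type u) [NormedAddCommGroup 𝓗] [InnerProductSpace ℂ 𝓗] [CompleteSpace 𝓗] where
  /-- The spectral projection of a set. -/
  proj : Set ℝ → 𝓗 →L[ℂ] 𝓗
  /-- Every `proj A` is an orthogonal projection. -/
  isStarProjection : ∀ A, IsStarProjection (proj A)
  /-- Convention off the Borel sets. -/
  not_measurable : ∀ A, ¬ MeasurableSet A → proj A = 0
  univ : proj Set.univ = 1
  inter : ∀ A B, MeasurableSet A → MeasurableSet B → proj (A ∩ B) = proj A * proj B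
  /-- Strong countable additivity. -/
  hasSum : ∀ A : ℕ → Set ℝ, (∀ n, MeasurableSet (A n)) → Pairwise (Function.onFun Disjoint A) →
    ∀ ψ : 𝓗, HasSum (fun n => proj (A n) ψ) (proj (⋃ n, A n) ψ)

variable {𝓗 : Type u} [NormedAddCommGroup 𝓗] [InnerProductSpace ℂ 𝓗] [CompleteSpace 𝓗]

namespace PVM

variable (E : PVM 𝓗)

theorem proj_empty : E.proj ∅ = 0 := by
  ext ψ
  have h := E.hasSum (fun _ => ∅) (fun _ => MeasurableSet.empty)
    (fun _ _ _ => Set.disjoint_empty _) ψ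
  have h' := h.summable.tendsto_atTop_zero
  simpa using tendsto_nhds_unique tendsto_const_nhds h'

theorem inner_proj_self (A : Set ℝ) (ψ : 𝓗) :
    inner ℂ ψ (E.proj A ψ) = ((‖E.proj A ψ‖ ^ 2 : ℝ) : ℂ) := by
  have h1 : E.proj A (E.proj A ψ) = E.proj A ψ :=
    congrArg (fun T : 𝓗 →L[ℂ] 𝓗 => T ψ) (E.isStarProjection A).isIdempotentElem
  have h2 := (E.isStarProjection A).isSelfAdjoint.isSymmetric ψ (E.proj A ψ)
  simp only [ContinuousLinearMap.coe_coe] at h2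
  rw [h1] at h2
  rw [← h2, inner_self_eq_norm_sq_to_K]
  simp

theorem inner_proj_of_disjoint {A B : Set ℝ} (hA : MeasurableSet A) (hB : MeasurableSet B)
    (h : Disjoint A B) (φ ψ : 𝓗) : inner ℂ (E.proj A φ) (E.proj B ψ) = 0 := by
  have h2 := (E.isStarProjection A).isSelfAdjoint.isSymmetric φ (E.proj B ψ)
  simp only [ContinuousLinearMap.coe_coe] at h2
  have h3 : E.proj A (E.proj B ψ) = 0 := by
    have := E.inter A B hA hB
    rw [Set.disjoint_iff_inter_eq_empty.mp h, E.proj_empty] at this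
    exact (congrArg (fun T : 𝓗 →L[ℂ] 𝓗 => T ψ) this).symm
  rw [h2, h3, inner_zero_right]

/-- The scalar spectral measure `A ↦ ⟪ψ, E(A) ψ⟫ = ‖E(A) ψ‖²` of a vector `ψ`. -/
noncomputable def scalarMeasure (ψ : 𝓗) : Measure ℝ :=
  Measure.ofMeasurable (fun A _ => ENNReal.ofReal (‖E.proj A ψ‖ ^ 2))
    (by simp [E.proj_empty])
    (by
      intro A hA hd
      have h := ((innerSL ℂ ψ).hasSum (E.hasSum A hA hd ψ)).mapL Complex.reCLM
      simp only [innerSL_apply_apply, inner_proj_self, Complex.reCLM_apply,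
        Complex.ofReal_re] at h
      rw [← h.tsum_eq, ENNReal.ofReal_tsum_of_nonneg (fun n => by positivity) h.summable])

theorem scalarMeasure_apply (ψ : 𝓗) {A : Set ℝ} (hA : MeasurableSet A) :
    E.scalarMeasure ψ A = ENNReal.ofReal (‖E.proj A ψ‖ ^ 2) :=
  Measure.ofMeasurable_apply A hA

theorem scalarMeasure_apply' (ψ : 𝓗) {A : Set ℝ} (hA : MeasurableSet A) :
    E.scalarMeasure ψ A = ‖E.proj A ψ‖ₑ ^ 2 := by
  rw [E.scalarMeasure_apply ψ hA, ENNReal.ofReal_pow (norm_nonneg _), ofReal_norm]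

theorem scalarMeasure_eq_zero_iff (ψ : 𝓗) {A : Set ℝ} (hA : MeasurableSet A) :
    E.scalarMeasure ψ A = 0 ↔ E.proj A ψ = 0 := by
  rw [E.scalarMeasure_apply' ψ hA]; simp

theorem scalarMeasure_zero : E.scalarMeasure 0 = 0 := by
  ext A hA
  simp [E.scalarMeasure_apply' 0 hA]

theorem scalarMeasure_smul (c : ℂ) (ψ : 𝓗) :
    E.scalarMeasure (c • ψ) = (‖c‖ₑ ^ 2) • E.scalarMeasure ψ := by
  ext A hA
  simp [E.scalarMeasure_apply' _ hA, enorm_smul, mul_pow]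

theorem scalarMeasure_add_le (φ ψ : 𝓗) :
    E.scalarMeasure (φ + ψ) ≤ (2 : ℝ≥0∞) • (E.scalarMeasure φ + E.scalarMeasure ψ) := by
  refine Measure.le_iff.mpr fun A hA => ?_
  simp only [Measure.smul_apply, Measure.add_apply, smul_eq_mul]
  rw [E.scalarMeasure_apply _ hA, E.scalarMeasure_apply _ hA, E.scalarMeasure_apply _ hA,
    ← ENNReal.ofReal_add (by positivity) (by positivity),
    show (2 : ℝ≥0∞) = ENNReal.ofReal 2 by simp, ← ENNReal.ofReal_mul (by norm_num), map_add]
  apply ENNReal.ofReal_le_ofReal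
  have h := norm_add_le (E.proj A φ) (E.proj A ψ)
  have h0 := norm_nonneg (E.proj A φ + E.proj A ψ)
  nlinarith [sq_nonneg (‖E.proj A φ‖ - ‖E.proj A ψ‖)]

/-! ### Functional calculus -/

/-- The integral `∫ s dE = ∑ x, x E({s = x})` of a simple function. -/
noncomputable def simpleIntegral (s : SimpleFunc ℝ ℂ) : 𝓗 →L[ℂ] 𝓗 :=
  ∑ x ∈ s.range, x • E.proj (s ⁻¹' {x})

theorem simpleIntegral_sub (s t : SimpleFunc ℝ ℂ) :
    E.simpleIntegral (s - t) = E.simpleIntegral s - E.simpleIntegral t := by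
  let T : Set ℝ → ℂ →L[ℝ] (𝓗 →L[ℂ] 𝓗) := fun A =>
    (ContinuousLinearMap.toSpanSingleton ℂ (E.proj A)).restrictScalars ℝ
  have hT : FinMeasAdditive (0 : Measure ℝ) T := by
    intro A B hA hB _ _ hd
    have hAB : E.proj (A ∪ B) = E.proj A + E.proj B := by
      ext ψ
      have hU : A ∪ B = ⋃ n : ℕ, (fun n => if n = 0 then A else if n = 1 then B else ∅) n := by
        ext x
        simp only [Set.mem_union, Set.mem_iUnion]
        constructor
        · rintro (h | h)
          · exact ⟨0, by simpa using h⟩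
          · exact ⟨1, by simpa using h⟩
        · rintro ⟨n, hn⟩
          split_ifs at hn
          · exact Or.inl hn
          · exact Or.inr hn
          · exact absurd hn (Set.notMem_empty x)
      have h := E.hasSum (fun n => if n = 0 then A else if n = 1 then B else ∅)
        (fun n => by split_ifs <;> simp [hA, hB])
        (fun i j hij => by
          simp only [Function.onFun]
          split_ifs <;> first | exact hd | exact hd.symm | exact Set.disjoint_empty _ |
            exact Set.empty_disjoint _ | omega) ψ
      rw [← hU] at h
      have h2 := hasSum_sum_of_ne_finset_zero (L := SummationFilter.unconditional ℕ) (s := Finset.range 2)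
        (f := fun n => E.proj ((fun n => if n = 0 then A else if n = 1 then B else ∅) n) ψ)
        (fun n hn => by
          have h0 : n ≠ 0 := by rintro rfl; simp at hn
          have h1 : n ≠ 1 := by rintro rfl; simp at hn
          simp [h0, h1, E.proj_empty])
      have := h.unique h2
      simpa [Finset.sum_range_succ] using this
    ext1
    simp [T, hAB]
  have hi : ∀ f : SimpleFunc ℝ ℂ, Integrable f (0 : Measure ℝ) := fun f => by simp
  have hs : ∀ f : SimpleFunc ℝ ℂ, E.simpleIntegral f = f.setToSimpleFunc T := fun f => by
    simp [simpleIntegral, SimpleFunc.setToSimpleFunc, T]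
  rw [hs, hs, hs]
  exact SimpleFunc.setToSimpleFunc_sub T hT (hi s) (hi t)

theorem norm_sq_simpleIntegral (s : SimpleFunc ℝ ℂ) (ψ : 𝓗) :
    ‖E.simpleIntegral s ψ‖ₑ ^ 2 = ∫⁻ x, ‖s x‖ₑ ^ 2 ∂(E.scalarMeasure ψ) := by
  have h1 : ∫⁻ x, ‖s x‖ₑ ^ 2 ∂(E.scalarMeasure ψ)
      = ∑ x ∈ s.range, ‖x‖ₑ ^ 2 * ‖E.proj (s ⁻¹' {x}) ψ‖ₑ ^ 2 := by
    have := SimpleFunc.map_lintegral (μ := E.scalarMeasure ψ) (fun z : ℂ => ‖z‖ₑ ^ 2) s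
    rw [← SimpleFunc.lintegral_eq_lintegral] at this
    refine this.trans (Finset.sum_congr rfl fun x _ => ?_)
    rw [E.scalarMeasure_apply' ψ (s.measurableSet_fiber x)]
  have h2 : ‖E.simpleIntegral s ψ‖ ^ 2
      = ∑ x ∈ s.range, ‖x • E.proj (s ⁻¹' {x}) ψ‖ ^ 2 := by
    have hc : ((‖E.simpleIntegral s ψ‖ ^ 2 : ℝ) : ℂ)
        = ((∑ x ∈ s.range, ‖x • E.proj (s ⁻¹' {x}) ψ‖ ^ 2 : ℝ) : ℂ) := by
      have e : E.simpleIntegral s ψ = ∑ x ∈ s.range, x • E.proj (s ⁻¹' {x}) ψ := by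
        simp [simpleIntegral]
      have n := inner_self_eq_norm_sq_to_K (𝕜 := ℂ) (E.simpleIntegral s ψ)
      push_cast
      simp only [RCLike.ofReal_eq_complex_ofReal] at n
      rw [← n, e, sum_inner]
      refine Finset.sum_congr rfl fun x hx => ?_
      rw [inner_sum, Finset.sum_eq_single x]
      · have m := inner_self_eq_norm_sq_to_K (𝕜 := ℂ) (x • E.proj (s ⁻¹' {x}) ψ)
        simpa using m
      · intro y _ hy
        rw [inner_smul_left, inner_smul_right, E.inner_proj_of_disjoint (s.measurableSet_fiber x)
          (s.measurableSet_fiber y)]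
        · simp
        · exact Disjoint.preimage _ (by simpa using hy.symm)
      · exact fun h => absurd hx h
    exact_mod_cast hc
  rw [h1, ← ofReal_norm, ← ENNReal.ofReal_pow (norm_nonneg _), h2,
    ENNReal.ofReal_sum_of_nonneg (fun _ _ => by positivity)]
  refine Finset.sum_congr rfl fun x _ => ?_
  rw [ENNReal.ofReal_pow (norm_nonneg _), ofReal_norm, enorm_smul, mul_pow]

/-- Simple functions converging pointwise to `g`, with absolute values at most `2 |g|`. -/
noncomputable def approx (g : ℝ → ℂ) (hg : Measurable g) (n : ℕ) : SimpleFunc ℝ ℂ :=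
  SimpleFunc.approxOn g hg Set.univ 0 (Set.mem_univ 0) n

/-- The vector `(∫ g dE) ψ`, for `g` a Borel function with `∫ |g|² d⟪ψ, E ψ⟫ < ∞`, as the limit of
the integrals of simple functions; see `tendsto_integral`. -/
noncomputable def integral (g : ℝ → ℂ) (hg : Measurable g) (ψ : 𝓗) : 𝓗 :=
  limUnder atTop fun n => E.simpleIntegral (approx g hg n) ψ

theorem enorm_simpleIntegral (s : SimpleFunc ℝ ℂ) (ψ : 𝓗) :
    ‖E.simpleIntegral s ψ‖ₑ = eLpNorm s 2 (E.scalarMeasure ψ) := by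
  have h : eLpNorm s 2 (E.scalarMeasure ψ) ^ 2 = ∫⁻ x, ‖s x‖ₑ ^ 2 ∂(E.scalarMeasure ψ) := by
    have := eLpNorm_nnreal_pow_eq_lintegral (μ := E.scalarMeasure ψ) (f := s) (p := 2) (by simp)
    simpa using this
  rw [← E.norm_sq_simpleIntegral s ψ] at h
  exact (ENNReal.pow_right_strictMono two_ne_zero).injective h.symm

/-- The limit defining `(∫ g dE) ψ` exists for `g ∈ L²`. -/
theorem tendsto_integral (g : ℝ → ℂ) (hg : Measurable g) (ψ : 𝓗)
    (h : ∫⁻ x, ‖g x‖ₑ ^ 2 ∂(E.scalarMeasure ψ) < ∞) :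
    Tendsto (fun n => E.simpleIntegral (approx g hg n) ψ) atTop (𝓝 (E.integral g hg ψ)) := by
  have hfin : eLpNorm (fun x => g x - 0) 2 (E.scalarMeasure ψ) < ∞ := by
    have := eLpNorm_nnreal_pow_eq_lintegral (μ := E.scalarMeasure ψ) (f := g) (p := 2) (by simp)
    have h2 : eLpNorm g 2 (E.scalarMeasure ψ) ^ 2 = ∫⁻ x, ‖g x‖ₑ ^ 2 ∂(E.scalarMeasure ψ) := by
      simpa using this
    rw [← h2] at h
    simpa using h
  have hlim : Tendsto (fun n => eLpNorm (⇑(approx g hg n) - g) 2 (E.scalarMeasure ψ)) atTop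
      (𝓝 0) :=
    SimpleFunc.tendsto_approxOn_Lp_eLpNorm hg (Set.mem_univ 0) (by simp) (by simp) hfin
  refine CauchySeq.tendsto_limUnder (EMetric.cauchySeq_iff.mpr fun ε hε => ?_)
  have hε2 : 0 < ε / 2 := ENNReal.half_pos hε.ne'
  obtain ⟨N, hN⟩ := eventually_atTop.mp (hlim.eventually (gt_mem_nhds hε2))
  refine ⟨N, fun m hm n hn => ?_⟩
  have e : E.simpleIntegral (approx g hg m) ψ - E.simpleIntegral (approx g hg n) ψ
      = E.simpleIntegral (approx g hg m - approx g hg n) ψ := by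
    rw [simpleIntegral_sub]; rfl
  rw [edist_eq_enorm_sub, e, enorm_simpleIntegral]
  have e2 : (⇑(approx g hg m - approx g hg n) : ℝ → ℂ)
      = (⇑(approx g hg m) - g) - (⇑(approx g hg n) - g) := by
    ext x; simp
  rw [e2]
  calc _ ≤ eLpNorm (⇑(approx g hg m) - g) 2 (E.scalarMeasure ψ)
        + eLpNorm (⇑(approx g hg n) - g) 2 (E.scalarMeasure ψ) :=
        eLpNorm_sub_le ((approx g hg m).measurable.sub hg).aestronglyMeasurable
          ((approx g hg n).measurable.sub hg).aestronglyMeasurable (by norm_num)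
    _ < ε / 2 + ε / 2 := ENNReal.add_lt_add (hN m hm) (hN n hn)
    _ = ε := ENNReal.add_halves ε

/-- The (in general unbounded) normal operator `g(H) = ∫ g dE` of a Borel function `g`, on its
natural domain `{ψ | ∫ |g|² d⟪ψ, E ψ⟫ < ∞}`. -/
noncomputable def funCalc (g : ℝ → ℂ) (hg : Measurable g) : 𝓗 →ₗ.[ℂ] 𝓗 where
  domain :=
    { carrier := {ψ | ∫⁻ x, ‖g x‖ₑ ^ 2 ∂(E.scalarMeasure ψ) < ∞}
      zero_mem' := by simp [E.scalarMeasure_zero]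
      add_mem' := by
        intro φ ψ hφ hψ
        refine (lintegral_mono' (E.scalarMeasure_add_le φ ψ) le_rfl).trans_lt ?_
        rw [lintegral_smul_measure, lintegral_add_measure]
        exact ENNReal.mul_lt_top (by simp) (ENNReal.add_lt_top.mpr ⟨hφ, hψ⟩)
      smul_mem' := by
        intro c ψ hψ
        simp only [Set.mem_ofPred_eq] at hψ ⊢
        rw [E.scalarMeasure_smul, lintegral_smul_measure]
        exact ENNReal.mul_lt_top (by simp) hψ }
  toFun :=
    { toFun := fun ψ => E.integral g hg ψ
      map_add' := by
        intro φ ψ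
        refine tendsto_nhds_unique (E.tendsto_integral g hg _ (φ + ψ).2) ?_
        simpa using (E.tendsto_integral g hg _ φ.2).add (E.tendsto_integral g hg _ ψ.2)
      map_smul' := by
        intro c ψ
        refine tendsto_nhds_unique (E.tendsto_integral g hg _ (c • ψ).2) ?_
        simpa using (E.tendsto_integral g hg _ ψ.2).const_smul c }

/-- The unitary `e^{itH} = ∫ e^{itx} dE(x)`; the integrand is bounded, so it is defined on all
vectors. -/
noncomputable def expI (t : ℝ) (ψ : 𝓗) : 𝓗 :=
  E.integral (fun x => Complex.exp (Complex.I * t * x)) (by fun_prop) ψ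

/-! ### Absolutely continuous subspace -/

/-- The subspace of absolute continuity: all `ψ` whose scalar spectral measure is absolutely
continuous with respect to Lebesgue measure. -/
noncomputable def acSubspace : Submodule ℂ 𝓗 where
  carrier := {ψ | E.scalarMeasure ψ ≪ volume}
  zero_mem' := by
    simp only [Set.mem_ofPred_eq, E.scalarMeasure_zero]
    exact Measure.AbsolutelyContinuous.zero _
  add_mem' := by
    intro φ ψ hφ hψ
    refine (Measure.absolutelyContinuous_of_le_smul (E.scalarMeasure_add_le φ ψ)).trans ?_
    exact Measure.AbsolutelyContinuous.add_left hφ hψ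
  smul_mem' := by
    intro c ψ hψ
    simp only [Set.mem_ofPred_eq, E.scalarMeasure_smul] at hψ ⊢
    exact hψ.smul_left _

theorem isClosed_acSubspace : IsClosed (E.acSubspace : Set 𝓗) := by
  have h : (E.acSubspace : Set 𝓗)
      = ⋂ (A : Set ℝ) (_ : MeasurableSet A) (_ : volume A = 0), {ψ | E.proj A ψ = 0} := by
    ext ψ
    simp only [Set.mem_iInter, Set.mem_ofPred_eq]
    constructor
    · intro hψ A hA h0
      exact (E.scalarMeasure_eq_zero_iff ψ hA).mp (hψ h0)
    · intro hψ
      exact Measure.AbsolutelyContinuous.mk fun A hA h0 =>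
        (E.scalarMeasure_eq_zero_iff ψ hA).mpr (hψ A hA h0)
  rw [h]
  exact isClosed_iInter fun A => isClosed_iInter fun _ => isClosed_iInter fun _ =>
    isClosed_eq (E.proj A).continuous continuous_const

instance : E.acSubspace.HasOrthogonalProjection :=
  haveI : CompleteSpace E.acSubspace := E.isClosed_acSubspace.completeSpace_coe
  Submodule.HasOrthogonalProjection.ofCompleteSpace _

/-- `P^ac`, the orthogonal projection onto the subspace of absolute continuity. -/
noncomputable def acProj : 𝓗 →L[ℂ] 𝓗 := E.acSubspace.starProjection

/-- The projection-valued measure concentrated at `0`. -/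
noncomputable def diracZero (𝓗 : Type u) [NormedAddCommGroup 𝓗] [InnerProductSpace ℂ 𝓗]
    [CompleteSpace 𝓗] : PVM 𝓗 := by
  classical
  exact
  { proj := fun A => if MeasurableSet A ∧ (0 : ℝ) ∈ A then 1 else 0
    isStarProjection := fun A => by
      split_ifs
      · exact IsStarProjection.one _
      · exact IsStarProjection.zero _
    not_measurable := fun A hA => by simp [hA]
    univ := by simp
    inter := fun A B hA hB => by
      by_cases h1 : (0 : ℝ) ∈ A <;> by_cases h2 : (0 : ℝ) ∈ B <;> simp [hA, hB, h1, h2]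
    hasSum := fun A hA hd ψ => by
      by_cases h : ∃ n, (0 : ℝ) ∈ A n
      · obtain ⟨n, hn⟩ := h
        have hU : MeasurableSet (⋃ n, A n) ∧ (0 : ℝ) ∈ ⋃ n, A n :=
          ⟨MeasurableSet.iUnion hA, Set.mem_iUnion.mpr ⟨n, hn⟩⟩
        have h' := hasSum_single (f := fun m =>
          (if MeasurableSet (A m) ∧ (0 : ℝ) ∈ A m then (1 : 𝓗 →L[ℂ] 𝓗) else 0) ψ) n
          (fun m hm => by
            have : (0 : ℝ) ∉ A m := fun h0 => Set.disjoint_left.mp (hd hm) h0 hn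
            simp [this])
        simpa [hA, hn, hU] using h'
      · have hU : (0 : ℝ) ∉ ⋃ n, A n := fun h0 => h (Set.mem_iUnion.mp h0)
        have hn : ∀ n, (0 : ℝ) ∉ A n := fun n hn => h ⟨n, hn⟩
        simpa [hU, hn] using (hasSum_zero : HasSum (fun _ : ℕ => (0 : 𝓗)) 0) }

instance : Nonempty (PVM 𝓗) := ⟨diracZero 𝓗⟩

end PVM

/-! ### Self-adjoint operators and scattering theory -/

/-- The spectral measure of a self-adjoint operator `H`: the projection-valued measure `E` with
`H = ∫ x dE(x)`, as an equality of unbounded operators including their domains. By the spectral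
theorem it exists and is unique for every self-adjoint `H`; there is no claim for other `H`. -/
noncomputable def spectralMeasure (H : 𝓗 →ₗ.[ℂ] 𝓗) : PVM 𝓗 :=
  Classical.epsilon fun E : PVM 𝓗 => E.funCalc (fun x => (x : ℂ)) (by fun_prop) = H

/-- `f(H)` for a continuous real-valued function `f`, on its natural domain. -/
noncomputable def funOf (f : C(ℝ, ℝ)) (H : 𝓗 →ₗ.[ℂ] 𝓗) : 𝓗 →ₗ.[ℂ] 𝓗 :=
  (spectralMeasure H).funCalc (fun x => (f x : ℂ)) (by fun_prop)

/-- `e^{itH}`. -/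
noncomputable def expI (t : ℝ) (H : 𝓗 →ₗ.[ℂ] 𝓗) (ψ : 𝓗) : 𝓗 := (spectralMeasure H).expI t ψ

/-- `P^ac(H)`, the projection onto the absolutely continuous subspace of `H`. -/
noncomputable def pac (H : 𝓗 →ₗ.[ℂ] 𝓗) : 𝓗 →L[ℂ] 𝓗 := (spectralMeasure H).acProj

/-- `H` has purely absolutely continuous spectrum: its absolutely continuous subspace is `𝓗`. -/
def PurelyAC (H : 𝓗 →ₗ.[ℂ] 𝓗) : Prop := (spectralMeasure H).acSubspace = ⊤

/-- `W` is the strong limit of `e^{-itH₁} e^{itH₀} P^ac(H₀)` as `t` tends along `l`. With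
`l = atTop` this says that `W₊(H₁, H₀)` exists and equals `W`, with `l = atBot` that `W₋(H₁, H₀)`
exists and equals `W`. -/
def IsWaveOperator (l : Filter ℝ) (H₁ H₀ : 𝓗 →ₗ.[ℂ] 𝓗) (W : 𝓗 →L[ℂ] 𝓗) : Prop :=
  ∀ ψ : 𝓗, Tendsto (fun t : ℝ => expI (-t) H₁ (expI t H₀ (pac H₀ ψ))) l (𝓝 (W ψ))

/-- Boundedness of a partially defined operator on its domain. -/
def IsBoundedOp (T : 𝓗 →ₗ.[ℂ] 𝓗) : Prop :=
  ∃ C : ℝ, ∀ ψ : T.domain, ‖T ψ‖ ≤ C * ‖(ψ : 𝓗)‖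

/-- The pair `(H₁, H₀)` is `f`-bounded: both wave operators `W±(H₁, H₀)` exist, and the operators
`(W±(H₁, H₀) - P^ac(H₁) P^ac(H₀)) f(H₀)` are bounded. -/
def FBounded (f : C(ℝ, ℝ)) (H₁ H₀ : 𝓗 →ₗ.[ℂ] 𝓗) : Prop :=
  ∀ l ∈ ({atTop, atBot} : Set (Filter ℝ)), ∃ W : 𝓗 →L[ℂ] 𝓗, IsWaveOperator l H₁ H₀ W ∧
    IsBoundedOp ((W - pac H₁ * pac H₀).toLinearMap.compPMap (funOf f H₀))

/-- Mutual `f`-boundedness, `H₁ ∼_f H₀`. -/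
def MutuallyFBounded (f : C(ℝ, ℝ)) (H₁ H₀ : 𝓗 →ₗ.[ℂ] 𝓗) : Prop :=
  FBounded f H₁ H₀ ∧ FBounded f H₀ H₁

end Scattering

/-!
Everything is a statement about the projection-valued measures `E` of the operators involved; how
they arise from the operators plays no role.

The functional calculus of bounded Borel functions is multiplicative
(`PVM.integral_mul_of_bounded`), so `t ↦ e^{itH}` is a unitary group, and the Fourier transform of
the scalar spectral measure of `ψ` is `t ↦ ⟪ψ, e^{itH} ψ⟫` (`PVM.charFun_scalarMeasure`). A wave
operator `W = W(K, H)` satisfies `W e^{isH} = e^{isK} W` and is a partial isometry with initial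
projection `P^ac(H)`. Uniqueness of Fourier transforms of finite measures therefore shows that the
spectral measure of `W ψ` with respect to `K` is that of `P^ac(H) ψ` with respect to `H`
(`PVM.IsWaveLimit.scalarMeasure_apply`). Two consequences follow: the range of `W` lies in the
absolutely continuous subspace of `K`, which gives the chain rule
`W(H₀, H₂) = W(H₀, H₁) W(H₁, H₂)` (`PVM.IsWaveLimit.comp`); and `W` intertwines the spectral
projections (`PVM.IsWaveLimit.intertwines`), so `f(K) W = W f(H)` on the domain of `f(H)`, and
likewise `P^ac(H)` commutes with `f(H)`.

With `Pⱼ = P^ac(Hⱼ)`, `V = W(H₀, H₁)`, `W = W(H₁, H₂)`, the assertion now follows from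
`(V W - P₀ P₂) f(H₂) = P₀ P₁ (W - P₁ P₂) f(H₂) + (V - P₀ P₁) f(H₁) W - P₀ (1 - P₁) f(H₂) P₂`,
where every term on the right is bounded (`FBounded.trans`). If the spectra are purely absolutely
continuous, `1 - P₁ = 0` and transitivity holds unconditionally; reflexivity is `W(H, H) = P^ac(H)`
and symmetry is built into the definition.
-/

open MeasureTheory Filter Topology
open scoped ENNReal

namespace Scattering

universe u

variable {𝓗 : Type u} [NormedAddCommGroup 𝓗] [InnerProductSpace ℂ 𝓗] [CompleteSpace 𝓗]

namespace PVM

variable (E F : PVM 𝓗)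

/-! ### Integrals of simple functions -/

theorem proj_univ_apply (ψ : 𝓗) : E.proj Set.univ ψ = ψ := by simp [E.univ]

theorem scalarMeasure_univ (ψ : 𝓗) : E.scalarMeasure ψ Set.univ = ‖ψ‖ₑ ^ 2 := by
  rw [E.scalarMeasure_apply' ψ MeasurableSet.univ, E.proj_univ_apply]

instance isFiniteMeasure_scalarMeasure (ψ : 𝓗) : IsFiniteMeasure (E.scalarMeasure ψ) :=
  ⟨by rw [scalarMeasure_univ]; exact ENNReal.pow_lt_top enorm_lt_top⟩

theorem proj_comm {A B : Set ℝ} (hA : MeasurableSet A) (hB : MeasurableSet B) :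
    E.proj A * E.proj B = E.proj B * E.proj A := by
  rw [← E.inter A B hA hB, Set.inter_comm, E.inter B A hB hA]

theorem proj_add_proj_compl_apply {A : Set ℝ} (hA : MeasurableSet A) (ψ : 𝓗) :
    E.proj A ψ + E.proj Aᶜ ψ = ψ := by
  have h := E.hasSum (fun n => if n = 0 then A else if n = 1 then Aᶜ else ∅)
    (fun n => by split_ifs <;> simp [hA])
    (fun i j hij => by
      simp only [Function.onFun]
      split_ifs <;> first | exact disjoint_compl_right | exact disjoint_compl_left |
        exact Set.disjoint_empty _ | exact Set.empty_disjoint _ | omega) ψ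
  have hU : (⋃ n : ℕ, if n = 0 then A else if n = 1 then Aᶜ else ∅) = Set.univ := by
    refine Set.eq_univ_of_forall fun x => Set.mem_iUnion.mpr ?_
    by_cases hx : x ∈ A
    · exact ⟨0, by simpa using hx⟩
    · exact ⟨1, by simpa using hx⟩
  rw [hU, proj_univ_apply] at h
  have h2 := hasSum_sum_of_ne_finset_zero (L := SummationFilter.unconditional ℕ)
    (s := Finset.range 2)
    (f := fun n => E.proj (if n = 0 then A else if n = 1 then Aᶜ else ∅) ψ)
    (fun n hn => by
      have h0 : n ≠ 0 := by rintro rfl; simp at hn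
      have h1 : n ≠ 1 := by rintro rfl; simp at hn
      simp [h0, h1, E.proj_empty])
  simpa [Finset.sum_range_succ] using (h.unique h2).symm

theorem simpleIntegral_piecewise (c : ℂ) {A : Set ℝ} (hA : MeasurableSet A) :
    E.simpleIntegral (SimpleFunc.piecewise A hA (SimpleFunc.const ℝ c) (SimpleFunc.const ℝ 0))
      = c • E.proj A := by
  let T : Set ℝ → ℂ →L[ℝ] (𝓗 →L[ℂ] 𝓗) := fun A =>
    (ContinuousLinearMap.toSpanSingleton ℂ (E.proj A)).restrictScalars ℝ
  have hs : ∀ f : SimpleFunc ℝ ℂ, E.simpleIntegral f = f.setToSimpleFunc T := fun f => by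
    simp [simpleIntegral, SimpleFunc.setToSimpleFunc, T]
  rw [hs, SimpleFunc.setToSimpleFunc_indicator T (by ext; simp [T, E.proj_empty])]
  simp [T]

theorem simpleIntegral_add (s t : SimpleFunc ℝ ℂ) :
    E.simpleIntegral (s + t) = E.simpleIntegral s + E.simpleIntegral t := by
  have h : s = (s + t) - t := by ext; simp
  nth_rw 2 [h]
  rw [simpleIntegral_sub, sub_add_cancel]

theorem simpleIntegral_mul (s t : SimpleFunc ℝ ℂ) :
    E.simpleIntegral (s * t) = E.simpleIntegral s * E.simpleIntegral t := by
  induction s using SimpleFunc.induction with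
  | @const c A hA =>
    induction t using SimpleFunc.induction with
    | @const d B hB =>
      have h : SimpleFunc.piecewise A hA (SimpleFunc.const ℝ c) (SimpleFunc.const ℝ 0)
          * SimpleFunc.piecewise B hB (SimpleFunc.const ℝ d) (SimpleFunc.const ℝ 0)
          = SimpleFunc.piecewise (A ∩ B) (hA.inter hB) (SimpleFunc.const ℝ (c * d))
            (SimpleFunc.const ℝ 0) := by
        ext x
        by_cases h1 : x ∈ A <;> by_cases h2 : x ∈ B <;> simp [h1, h2]
      rw [h, simpleIntegral_piecewise, simpleIntegral_piecewise, simpleIntegral_piecewise,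
        E.inter A B hA hB, smul_mul_smul_comm]
    | add _ hf hg => rw [mul_add, simpleIntegral_add, hf, hg, simpleIntegral_add, mul_add]
  | add _ hf hg => rw [add_mul, simpleIntegral_add, hf, hg, simpleIntegral_add, add_mul]

theorem simpleIntegral_one : E.simpleIntegral (1 : SimpleFunc ℝ ℂ) = 1 := by
  have h : (1 : SimpleFunc ℝ ℂ) = SimpleFunc.piecewise Set.univ MeasurableSet.univ
      (SimpleFunc.const ℝ 1) (SimpleFunc.const ℝ 0) := by
    ext x; simp
  rw [h, simpleIntegral_piecewise, E.univ, one_smul]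

/-- The weak form of the integral: `⟪ψ, (∫ s dE) ψ⟫ = ∫ s d⟪ψ, E ψ⟫`. -/
theorem inner_simpleIntegral_self (s : SimpleFunc ℝ ℂ) (ψ : 𝓗) :
    inner ℂ ψ (E.simpleIntegral s ψ) = SimpleFunc.integral (E.scalarMeasure ψ) s := by
  have e : E.simpleIntegral s ψ = ∑ x ∈ s.range, x • E.proj (s ⁻¹' {x}) ψ := by
    simp [simpleIntegral]
  rw [SimpleFunc.integral_eq, e, inner_sum]
  refine Finset.sum_congr rfl fun x _ => ?_
  rw [inner_smul_right, inner_proj_self, measureReal_def,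
    E.scalarMeasure_apply ψ (s.measurableSet_fiber x),
    ENNReal.toReal_ofReal (by positivity), Complex.real_smul, mul_comm]

/-! ### Integrals of measurable functions -/

theorem norm_approx_le (g : ℝ → ℂ) (hg : Measurable g) {C : ℝ} (hC : ∀ x, ‖g x‖ ≤ C) (n : ℕ)
    (x : ℝ) : ‖approx g hg n x‖ ≤ 2 * C := by
  have := SimpleFunc.norm_approxOn_zero_le hg (Set.mem_univ 0) x n
  simp only [approx]
  linarith [hC x]

theorem tendsto_approx (g : ℝ → ℂ) (hg : Measurable g) (x : ℝ) :
    Tendsto (fun n => approx g hg n x) atTop (𝓝 (g x)) :=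
  SimpleFunc.tendsto_approxOn hg (Set.mem_univ 0) (by simp)

theorem eLpNorm_two_sq (g : ℝ → ℂ) (μ : Measure ℝ) :
    eLpNorm g 2 μ ^ 2 = ∫⁻ x, ‖g x‖ₑ ^ 2 ∂μ := by
  simpa using eLpNorm_nnreal_pow_eq_lintegral (μ := μ) (f := g) (p := 2) (by simp)

theorem tendsto_eLpNorm_approx_sub (g : ℝ → ℂ) (hg : Measurable g) (μ : Measure ℝ)
    (h : ∫⁻ x, ‖g x‖ₑ ^ 2 ∂μ < ∞) :
    Tendsto (fun n => eLpNorm (g - ⇑(approx g hg n)) 2 μ) atTop (𝓝 0) := by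
  have hfin : eLpNorm (fun x => g x - 0) 2 μ < ∞ := by
    rw [← eLpNorm_two_sq] at h
    simpa using h
  simp_rw [eLpNorm_sub_comm g]
  exact SimpleFunc.tendsto_approxOn_Lp_eLpNorm hg (Set.mem_univ 0) (by simp) (by simp) hfin

/-- The vector `(∫ g dE) ψ` does not depend on the approximating sequence used to define it: any
simple function close to `g` in `L²` gives a vector close to it. -/
theorem enorm_simpleIntegral_sub_integral_le (s : SimpleFunc ℝ ℂ) (g : ℝ → ℂ) (hg : Measurable g)
    (ψ : 𝓗) (h : ∫⁻ x, ‖g x‖ₑ ^ 2 ∂(E.scalarMeasure ψ) < ∞) :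
    ‖E.simpleIntegral s ψ - E.integral g hg ψ‖ₑ ≤ eLpNorm (⇑s - g) 2 (E.scalarMeasure ψ) := by
  have h1 : Tendsto (fun n => ‖E.simpleIntegral s ψ - E.simpleIntegral (approx g hg n) ψ‖ₑ) atTop
      (𝓝 ‖E.simpleIntegral s ψ - E.integral g hg ψ‖ₑ) :=
    (continuous_enorm.tendsto _).comp (tendsto_const_nhds.sub (E.tendsto_integral g hg ψ h))
  have h2 := (tendsto_const_nhds (x := eLpNorm (⇑s - g) 2 (E.scalarMeasure ψ))).add
    (tendsto_eLpNorm_approx_sub g hg _ h)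
  rw [add_zero] at h2
  refine le_of_tendsto_of_tendsto' h1 h2 fun n => ?_
  have e : E.simpleIntegral s ψ - E.simpleIntegral (approx g hg n) ψ
      = E.simpleIntegral (s - approx g hg n) ψ := by
    rw [simpleIntegral_sub]; rfl
  have e2 : (⇑(s - approx g hg n) : ℝ → ℂ) = (⇑s - g) + (g - ⇑(approx g hg n)) := by
    ext x; simp
  rw [e, enorm_simpleIntegral, e2]
  exact eLpNorm_add_le (s.measurable.sub hg).aestronglyMeasurable
    (hg.sub (approx g hg n).measurable).aestronglyMeasurable (by norm_num)

theorem enorm_integral_le (g : ℝ → ℂ) (hg : Measurable g) (ψ : 𝓗)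
    (h : ∫⁻ x, ‖g x‖ₑ ^ 2 ∂(E.scalarMeasure ψ) < ∞) :
    ‖E.integral g hg ψ‖ₑ ≤ eLpNorm g 2 (E.scalarMeasure ψ) := by
  have h0 : E.simpleIntegral 0 = 0 := by
    have := E.simpleIntegral_sub 0 0
    simpa using this
  have := E.enorm_simpleIntegral_sub_integral_le 0 g hg ψ h
  simpa [h0] using this

theorem lintegral_lt_top_of_bounded (g : ℝ → ℂ) {C : ℝ} (hC : ∀ x, ‖g x‖ ≤ C) (ψ : 𝓗) :
    ∫⁻ x, ‖g x‖ₑ ^ 2 ∂(E.scalarMeasure ψ) < ∞ := by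
  calc ∫⁻ x, ‖g x‖ₑ ^ 2 ∂(E.scalarMeasure ψ)
      ≤ ∫⁻ _, ENNReal.ofReal C ^ 2 ∂(E.scalarMeasure ψ) := by
        gcongr with x
        rw [← ofReal_norm]
        exact ENNReal.ofReal_le_ofReal (hC x)
    _ < ∞ := by
        rw [lintegral_const]
        exact ENNReal.mul_lt_top (by simp) (measure_lt_top _ _)

/-- Dominated convergence for the vector-valued integrals of simple functions. -/
theorem tendsto_simpleIntegral_of_bounded (s : ℕ → SimpleFunc ℝ ℂ) (g : ℝ → ℂ) (hg : Measurable g)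
    {C : ℝ} (hs : ∀ n x, ‖s n x‖ ≤ C) (hlim : ∀ x, Tendsto (fun n => s n x) atTop (𝓝 (g x)))
    (ψ : 𝓗) :
    Tendsto (fun n => E.simpleIntegral (s n) ψ) atTop (𝓝 (E.integral g hg ψ)) := by
  have hgC : ∀ x, ‖g x‖ ≤ C := fun x => le_of_tendsto' (hlim x).norm fun n => hs n x
  have hfin := E.lintegral_lt_top_of_bounded g hgC ψ
  have hsq : Tendsto (fun n => ∫⁻ x, ‖(⇑(s n) - g) x‖ₑ ^ 2 ∂(E.scalarMeasure ψ)) atTop (𝓝 0) := by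
    have := tendsto_lintegral_of_dominated_convergence (μ := E.scalarMeasure ψ)
      (F := fun n x => ‖(⇑(s n) - g) x‖ₑ ^ 2) (f := fun _ => 0)
      (fun _ => ENNReal.ofReal (2 * C) ^ 2)
      (fun n => ((s n).measurable.sub hg).enorm.pow_const 2)
      (fun n => Eventually.of_forall fun x => by
        simp only
        gcongr
        rw [← ofReal_norm]
        refine ENNReal.ofReal_le_ofReal ((norm_sub_le _ _).trans ?_)
        linarith [hs n x, hgC x])
      (by
        rw [lintegral_const]
        exact (ENNReal.mul_lt_top (ENNReal.pow_lt_top ENNReal.ofReal_lt_top)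
          (measure_lt_top _ _)).ne)
      (Eventually.of_forall fun x => by
        have h1 : Tendsto (fun n => s n x - g x) atTop (𝓝 0) := by
          simpa using (hlim x).sub_const (g x)
        have h2 := (ENNReal.continuous_pow 2).tendsto _ |>.comp
          ((continuous_enorm.tendsto _).comp h1)
        simpa [Function.comp_def] using h2)
    simpa using this
  have hsqn : Tendsto (fun n => ‖E.simpleIntegral (s n) ψ - E.integral g hg ψ‖ₑ ^ 2) atTop
      (𝓝 0) := by
    refine tendsto_of_tendsto_of_tendsto_of_le_of_le tendsto_const_nhds hsq (fun n => by simp)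
      fun n => ?_
    simp only
    rw [← eLpNorm_two_sq]
    gcongr
    exact E.enorm_simpleIntegral_sub_integral_le (s n) g hg ψ hfin
  rw [tendsto_iff_norm_sub_tendsto_zero]
  have h3 : Tendsto (fun n => ‖E.simpleIntegral (s n) ψ - E.integral g hg ψ‖ ^ 2) atTop (𝓝 0) := by
    have := (ENNReal.tendsto_toReal ENNReal.zero_ne_top).comp hsqn
    simpa [Function.comp_def] using this
  simpa using h3.sqrt

theorem norm_simpleIntegral_le (s : SimpleFunc ℝ ℂ) {C : ℝ} (hC : ∀ x, ‖s x‖ ≤ C)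
    (ψ : 𝓗) : ‖E.simpleIntegral s ψ‖ ≤ C * ‖ψ‖ := by
  have hC0 : 0 ≤ C := (norm_nonneg _).trans (hC 0)
  have h : ‖E.simpleIntegral s ψ‖ₑ ^ 2 ≤ (ENNReal.ofReal C * ‖ψ‖ₑ) ^ 2 := by
    rw [norm_sq_simpleIntegral, mul_pow, ← scalarMeasure_univ E, ← lintegral_const]
    gcongr with x
    rw [← ofReal_norm]
    exact ENNReal.ofReal_le_ofReal (hC x)
  rw [ENNReal.pow_le_pow_left_iff two_ne_zero, ← ofReal_norm, ← ofReal_norm,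
    ← ENNReal.ofReal_mul hC0] at h
  exact (ENNReal.ofReal_le_ofReal_iff (by positivity)).mp h

theorem integral_mul_of_bounded (g h : ℝ → ℂ) (hg : Measurable g) (hh : Measurable h) {C D : ℝ}
    (hC : ∀ x, ‖g x‖ ≤ C) (hD : ∀ x, ‖h x‖ ≤ D) (ψ : 𝓗) :
    E.integral g hg (E.integral h hh ψ) = E.integral (fun x => g x * h x) (hg.mul hh) ψ := by
  have hC0 : 0 ≤ C := (norm_nonneg _).trans (hC 0)
  have hgψ := E.tendsto_integral g hg (E.integral h hh ψ) (E.lintegral_lt_top_of_bounded g hC _)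
  have hhψ := E.tendsto_integral h hh ψ (E.lintegral_lt_top_of_bounded h hD _)
  have hprod := E.tendsto_simpleIntegral_of_bounded (fun n => approx g hg n * approx h hh n)
    (fun x => g x * h x) (hg.mul hh) (C := (2 * C) * (2 * D))
    (fun n x => by
      simp only [SimpleFunc.coe_mul, Pi.mul_apply, norm_mul]
      exact mul_le_mul (norm_approx_le g hg hC n x) (norm_approx_le h hh hD n x)
        (norm_nonneg _) (by positivity))
    (fun x => by simpa using (tendsto_approx g hg x).mul (tendsto_approx h hh x)) ψ
  refine tendsto_nhds_unique ?_ hprod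
  -- the operators `∫ gₙ dE` are bounded uniformly in `n`, so the inner limit may be taken first
  have hdiff : Tendsto (fun n => E.simpleIntegral (approx g hg n)
      (E.simpleIntegral (approx h hh n) ψ - E.integral h hh ψ)) atTop (𝓝 0) := by
    refine squeeze_zero_norm (fun n => E.norm_simpleIntegral_le _ (norm_approx_le g hg hC n) _) ?_
    simpa using (tendsto_iff_norm_sub_tendsto_zero.mp hhψ).const_mul (2 * C)
  have := hdiff.add hgψ
  rw [zero_add] at this
  refine this.congr fun n => ?_
  rw [simpleIntegral_mul, map_sub, sub_add_cancel]
  rfl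

theorem inner_integral_self_of_bounded (g : ℝ → ℂ) (hg : Measurable g) {C : ℝ}
    (hC : ∀ x, ‖g x‖ ≤ C) (ψ : 𝓗) :
    inner ℂ ψ (E.integral g hg ψ) = ∫ x, g x ∂(E.scalarMeasure ψ) := by
  have h1 := ((innerSL ℂ ψ).continuous.tendsto _).comp
    (E.tendsto_integral g hg ψ (E.lintegral_lt_top_of_bounded g hC _))
  have hint : Integrable g (E.scalarMeasure ψ) :=
    Integrable.of_bound hg.aestronglyMeasurable C (Eventually.of_forall hC)
  have h2 := tendsto_integral_approxOn_of_measurable (s := Set.univ) hint hg (by simp)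
    (Set.mem_univ 0) (by simp)
  refine tendsto_nhds_unique h1 (h2.congr fun n => ?_)
  simp [← inner_simpleIntegral_self, approx]

/-! ### Intertwining operators -/

variable {E F}

/-- `T` intertwines the spectral projections of `E` with those of `F`. -/
def Intertwines (E F : PVM 𝓗) (T : 𝓗 →L[ℂ] 𝓗) : Prop :=
  ∀ A, MeasurableSet A → ∀ ψ, F.proj A (T ψ) = T (E.proj A ψ)

namespace Intertwines

variable {T : 𝓗 →L[ℂ] 𝓗} (hT : Intertwines E F T)
include hT

theorem scalarMeasure_le (ψ : 𝓗) :
    F.scalarMeasure (T ψ) ≤ (‖T‖ₑ ^ 2) • E.scalarMeasure ψ := by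
  refine Measure.le_iff.mpr fun A hA => ?_
  rw [Measure.smul_apply, smul_eq_mul, F.scalarMeasure_apply' _ hA, E.scalarMeasure_apply' _ hA,
    hT A hA, ← mul_pow]
  gcongr
  exact T.le_opENorm _

theorem lintegral_lt_top {g : ℝ → ℂ} {ψ : 𝓗}
    (h : ∫⁻ x, ‖g x‖ₑ ^ 2 ∂(E.scalarMeasure ψ) < ∞) :
    ∫⁻ x, ‖g x‖ₑ ^ 2 ∂(F.scalarMeasure (T ψ)) < ∞ := by
  refine (lintegral_mono' (hT.scalarMeasure_le ψ) le_rfl).trans_lt ?_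
  rw [lintegral_smul_measure]
  exact ENNReal.mul_lt_top (by simp) h

theorem map_mem_domain {g : ℝ → ℂ} {hg : Measurable g} {ψ : 𝓗}
    (h : ψ ∈ (E.funCalc g hg).domain) : T ψ ∈ (F.funCalc g hg).domain :=
  hT.lintegral_lt_top h

theorem map_mem_acSubspace {ψ : 𝓗} (h : ψ ∈ E.acSubspace) : T ψ ∈ F.acSubspace :=
  (Measure.absolutelyContinuous_of_le_smul (hT.scalarMeasure_le ψ)).trans h

theorem simpleIntegral (s : SimpleFunc ℝ ℂ) (ψ : 𝓗) :
    F.simpleIntegral s (T ψ) = T (E.simpleIntegral s ψ) := by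
  simp [PVM.simpleIntegral, map_sum, hT _ (s.measurableSet_fiber _)]

theorem integral (g : ℝ → ℂ) (hg : Measurable g) (ψ : 𝓗)
    (h : ∫⁻ x, ‖g x‖ₑ ^ 2 ∂(E.scalarMeasure ψ) < ∞) :
    F.integral g hg (T ψ) = T (E.integral g hg ψ) := by
  refine tendsto_nhds_unique (F.tendsto_integral g hg (T ψ) (hT.lintegral_lt_top h)) ?_
  simp_rw [hT.simpleIntegral]
  exact (T.continuous.tendsto _).comp (E.tendsto_integral g hg ψ h)

end Intertwines

theorem intertwines_proj (E : PVM 𝓗) {B : Set ℝ} (hB : MeasurableSet B) :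
    Intertwines E E (E.proj B) := fun _ hA ψ =>
  congrArg (fun T : 𝓗 →L[ℂ] 𝓗 => T ψ) (E.proj_comm hA hB)

theorem intertwines_acProj (E : PVM 𝓗) : Intertwines E E E.acProj := by
  intro A hA ψ
  refine (Submodule.eq_starProjection_of_mem_of_inner_eq_zero
    ((E.intertwines_proj hA).map_mem_acSubspace (Submodule.starProjection_apply_mem _ _))
    fun w hw => ?_).symm
  have hs := (E.isStarProjection A).isSelfAdjoint.isSymmetric
    (ψ - E.acSubspace.starProjection ψ) w
  simp only [ContinuousLinearMap.coe_coe] at hs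
  change inner ℂ (E.proj A ψ - E.proj A (E.acSubspace.starProjection ψ)) w = 0
  rw [← map_sub, hs]
  exact Submodule.starProjection_inner_eq_zero _ _
    ((E.intertwines_proj hA).map_mem_acSubspace hw)

theorem acProj_mem (E : PVM 𝓗) (ψ : 𝓗) : E.acProj ψ ∈ E.acSubspace :=
  Submodule.starProjection_apply_mem _ _

theorem acProj_of_mem {ψ : 𝓗} (h : ψ ∈ E.acSubspace) : E.acProj ψ = ψ :=
  Submodule.starProjection_eq_self_iff.mpr h

theorem norm_acProj_le (E : PVM 𝓗) (ψ : 𝓗) : ‖E.acProj ψ‖ ≤ ‖ψ‖ :=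
  Submodule.norm_starProjection_apply_le _ _

/-! ### The unitary group -/

theorem norm_expI_integrand_le (t x : ℝ) : ‖Complex.exp (Complex.I * t * x)‖ ≤ 1 := by
  rw [show Complex.I * t * x = ((t * x : ℝ) : ℂ) * Complex.I by push_cast; ring,
    Complex.norm_exp_ofReal_mul_I]

variable (E)

theorem expI_expI (s t : ℝ) (ψ : 𝓗) : E.expI s (E.expI t ψ) = E.expI (s + t) ψ := by
  rw [expI, expI, E.integral_mul_of_bounded _ _ _ _ (norm_expI_integrand_le s)
    (norm_expI_integrand_le t), expI]
  congr 1
  ext x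
  rw [← Complex.exp_add]
  push_cast
  ring_nf

theorem expI_zero (ψ : 𝓗) : E.expI 0 ψ = ψ := by
  have h := E.tendsto_simpleIntegral_of_bounded (fun _ => 1)
    (fun x : ℝ => Complex.exp (Complex.I * (0 : ℝ) * x)) (by fun_prop) (C := 1)
    (fun n x => by simp) (fun x => by simp) ψ
  have := tendsto_nhds_unique h tendsto_const_nhds
  rw [expI, this, simpleIntegral_one]
  rfl

theorem expI_neg_expI (t : ℝ) (ψ : 𝓗) : E.expI (-t) (E.expI t ψ) = ψ := by
  rw [expI_expI, neg_add_cancel, expI_zero]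

theorem expI_expI_neg (t : ℝ) (ψ : 𝓗) : E.expI t (E.expI (-t) ψ) = ψ := by
  rw [expI_expI, add_neg_cancel, expI_zero]

theorem norm_expI_le (t : ℝ) (ψ : 𝓗) : ‖E.expI t ψ‖ ≤ ‖ψ‖ := by
  have hfin := E.lintegral_lt_top_of_bounded _ (norm_expI_integrand_le t) ψ
  have h : ‖E.expI t ψ‖ₑ ^ 2 ≤ ‖ψ‖ₑ ^ 2 := by
    calc ‖E.expI t ψ‖ₑ ^ 2
        ≤ eLpNorm (fun x : ℝ => Complex.exp (Complex.I * t * x)) 2 (E.scalarMeasure ψ) ^ 2 := by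
          gcongr
          exact E.enorm_integral_le _ _ ψ hfin
      _ ≤ ∫⁻ _, 1 ∂(E.scalarMeasure ψ) := by
          rw [eLpNorm_two_sq]
          gcongr with x
          rw [← ofReal_norm, ← ENNReal.ofReal_pow (norm_nonneg _)]
          exact ENNReal.ofReal_le_one.mpr (pow_le_one₀ (norm_nonneg _)
            (norm_expI_integrand_le t x))
      _ = ‖ψ‖ₑ ^ 2 := by rw [lintegral_one, scalarMeasure_univ]
  rw [ENNReal.pow_le_pow_left_iff two_ne_zero, ← ofReal_norm, ← ofReal_norm] at h
  exact (ENNReal.ofReal_le_ofReal_iff (by positivity)).mp h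

theorem norm_expI (t : ℝ) (ψ : 𝓗) : ‖E.expI t ψ‖ = ‖ψ‖ := by
  refine le_antisymm (E.norm_expI_le t ψ) ?_
  conv_lhs => rw [← E.expI_neg_expI t ψ]
  exact E.norm_expI_le _ _

/-- The unitary `e^{itH}` as a linear isometry. -/
noncomputable def expIₗᵢ (t : ℝ) : 𝓗 →ₗᵢ[ℂ] 𝓗 where
  toFun := E.expI t
  map_add' φ ψ := (E.funCalc (fun x => Complex.exp (Complex.I * t * x)) (by fun_prop)).map_add
    ⟨φ, E.lintegral_lt_top_of_bounded _ (norm_expI_integrand_le t) φ⟩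
    ⟨ψ, E.lintegral_lt_top_of_bounded _ (norm_expI_integrand_le t) ψ⟩
  map_smul' c ψ := (E.funCalc (fun x => Complex.exp (Complex.I * t * x)) (by fun_prop)).map_smul
    c ⟨ψ, E.lintegral_lt_top_of_bounded _ (norm_expI_integrand_le t) ψ⟩
  norm_map' := E.norm_expI t

theorem continuous_expI (t : ℝ) : Continuous (E.expI t) := (E.expIₗᵢ t).continuous

theorem expI_sub (t : ℝ) (φ ψ : 𝓗) : E.expI t (φ - ψ) = E.expI t φ - E.expI t ψ :=
  (E.expIₗᵢ t).map_sub φ ψ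

theorem inner_expI_expI (t : ℝ) (φ ψ : 𝓗) :
    inner ℂ (E.expI t φ) (E.expI t ψ) = inner ℂ φ ψ :=
  (E.expIₗᵢ t).inner_map_map φ ψ

theorem acProj_expI (t : ℝ) (ψ : 𝓗) : E.acProj (E.expI t ψ) = E.expI t (E.acProj ψ) :=
  (E.intertwines_acProj.integral _ _ ψ
    (E.lintegral_lt_top_of_bounded _ (norm_expI_integrand_le t) ψ)).symm

/-- The Fourier transform of the scalar spectral measure of `ψ` is `t ↦ ⟪ψ, e^{itH} ψ⟫`. -/
theorem charFun_scalarMeasure (ψ : 𝓗) (t : ℝ) :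
    charFun (E.scalarMeasure ψ) t = inner ℂ ψ (E.expI t ψ) := by
  rw [expI, E.inner_integral_self_of_bounded _ _ (norm_expI_integrand_le t), charFun_apply_real]
  congr 1
  ext x
  ring_nf

end PVM

/-! ### Wave operators -/

namespace PVM

/-- `W` is the strong limit along `l` of `e^{-itK} e^{itH} P^ac(H)`, where `F` and `E` are the
spectral measures of `K` and `H`. -/
def IsWaveLimit (l : Filter ℝ) (F E : PVM 𝓗) (W : 𝓗 →L[ℂ] 𝓗) : Prop :=
  ∀ ψ : 𝓗, Tendsto (fun t : ℝ => F.expI (-t) (E.expI t (E.acProj ψ))) l (𝓝 (W ψ))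

theorem acProj_acProj (E : PVM 𝓗) (ψ : 𝓗) : E.acProj (E.acProj ψ) = E.acProj ψ :=
  acProj_of_mem (E.acProj_mem ψ)

theorem isWaveLimit_self (l : Filter ℝ) (E : PVM 𝓗) : IsWaveLimit l E E E.acProj := by
  intro ψ
  simp_rw [E.expI_neg_expI]
  exact tendsto_const_nhds

namespace IsWaveLimit

variable {l : Filter ℝ} [l.NeBot] {E F : PVM 𝓗} {W : 𝓗 →L[ℂ] 𝓗} (hW : IsWaveLimit l F E W)
include hW

theorem inner_apply_apply (φ ψ : 𝓗) :
    inner ℂ (W φ) (W ψ) = inner ℂ (E.acProj φ) (E.acProj ψ) := by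
  refine tendsto_nhds_unique ((hW φ).inner (hW ψ)) ?_
  simp_rw [inner_expI_expI]
  exact tendsto_const_nhds

/-- The intertwining relation `W e^{isH} = e^{isK} W`, for a filter invariant under translations:
replace `t` by `t + s` in the limit. -/
theorem apply_expI (hl : ∀ s : ℝ, Tendsto (fun t => t + s) l l) (s : ℝ) (ψ : 𝓗) :
    W (E.expI s ψ) = F.expI s (W ψ) := by
  refine tendsto_nhds_unique (hW (E.expI s ψ)) ?_
  refine (((F.continuous_expI s).tendsto _).comp ((hW ψ).comp (hl s))).congr fun t => ?_
  simp only [Function.comp_apply, acProj_expI, expI_expI]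
  rw [show s + -(t + s) = -t by ring]

/-- A wave operator carries the scalar spectral measure of the absolutely continuous part of a
vector to that of its image: the two measures have the same Fourier transform. -/
theorem scalarMeasure_apply (hl : ∀ s : ℝ, Tendsto (fun t => t + s) l l) (ψ : 𝓗) :
    F.scalarMeasure (W ψ) = E.scalarMeasure (E.acProj ψ) := by
  refine Measure.ext_of_charFun ?_
  ext t
  rw [charFun_scalarMeasure, charFun_scalarMeasure, ← hW.apply_expI hl, hW.inner_apply_apply,
    acProj_expI]

theorem apply_mem_acSubspace (hl : ∀ s : ℝ, Tendsto (fun t => t + s) l l) (ψ : 𝓗) :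
    W ψ ∈ F.acSubspace := by
  change F.scalarMeasure (W ψ) ≪ volume
  rw [hW.scalarMeasure_apply hl]
  exact E.acProj_mem ψ

/-- A wave operator intertwines the spectral projections. Both sides can be compared on `E(A) ψ` and
`E(Aᶜ) ψ` separately, where the equality of scalar spectral measures makes one of `F(A) W`,
`F(Aᶜ) W` vanish. -/
theorem intertwines (hl : ∀ s : ℝ, Tendsto (fun t => t + s) l l) : Intertwines E F W := by
  intro A hA ψ
  -- for disjoint `B`, `C` the vector `F(B) W E(C) ψ` has norm `‖E(B) E(C) P^ac ψ‖ = 0`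
  have key : ∀ B C, MeasurableSet B → MeasurableSet C → Disjoint B C →
      F.proj B (W (E.proj C ψ)) = 0 := by
    intro B C hB hC hd
    rw [← F.scalarMeasure_eq_zero_iff _ hB, hW.scalarMeasure_apply hl,
      E.scalarMeasure_eq_zero_iff _ hB, ← E.intertwines_acProj C hC]
    have := E.inter B C hB hC
    rw [Set.disjoint_iff_inter_eq_empty.mp hd, E.proj_empty] at this
    exact (congrArg (fun T : 𝓗 →L[ℂ] 𝓗 => T (E.acProj ψ)) this).symm
  have h1 := key A Aᶜ hA hA.compl disjoint_compl_right
  have h2 := key Aᶜ A hA.compl hA disjoint_compl_left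
  calc F.proj A (W ψ) = F.proj A (W (E.proj A ψ + E.proj Aᶜ ψ)) := by
        rw [E.proj_add_proj_compl_apply hA]
    _ = F.proj A (W (E.proj A ψ)) + F.proj Aᶜ (W (E.proj A ψ)) := by
        rw [map_add, map_add, h1, h2]
    _ = W (E.proj A ψ) := F.proj_add_proj_compl_apply hA _

/-- The chain rule for wave operators. -/
theorem comp (hl : ∀ s : ℝ, Tendsto (fun t => t + s) l l) {G : PVM 𝓗} {V : 𝓗 →L[ℂ] 𝓗}
    (hV : IsWaveLimit l G F V) : IsWaveLimit l G E (V * W) := by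
  intro ψ
  -- `e^{-itK} e^{itH} P^ac ψ` differs from `e^{-itK} e^{itL} (W ψ)` by a vector whose norm is
  -- `‖e^{-itL} e^{itH} P^ac ψ - W ψ‖`
  have h1 : Tendsto (fun t : ℝ => G.expI (-t)
      (F.expI t (F.expI (-t) (E.expI t (E.acProj ψ)) - W ψ))) l (𝓝 0) := by
    rw [tendsto_zero_iff_norm_tendsto_zero]
    simp_rw [norm_expI]
    exact tendsto_iff_norm_sub_tendsto_zero.mp (hW ψ)
  have h2 := hV (W ψ)
  rw [acProj_of_mem (hW.apply_mem_acSubspace hl ψ)] at h2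
  have h3 := h1.add h2
  rw [zero_add] at h3
  refine h3.congr fun t => ?_
  rw [expI_sub, expI_sub, sub_add_cancel, expI_expI_neg]

end IsWaveLimit

end PVM

/-! ### Boundedness relative to a function -/

theorem tendsto_add_const_of_mem {l : Filter ℝ} (hl : l ∈ ({atTop, atBot} : Set (Filter ℝ)))
    (s : ℝ) : Tendsto (fun t => t + s) l l := by
  rcases hl with rfl | rfl
  · exact tendsto_atTop_add_const_right _ _ tendsto_id
  · exact tendsto_atBot_add_const_right _ _ tendsto_id

theorem neBot_of_mem {l : Filter ℝ} (hl : l ∈ ({atTop, atBot} : Set (Filter ℝ))) : l.NeBot := by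
  rcases hl with rfl | rfl <;> infer_instance

theorem funOf_map {H K : 𝓗 →ₗ.[ℂ] 𝓗} {T : 𝓗 →L[ℂ] 𝓗} (f : C(ℝ, ℝ))
    (hT : (spectralMeasure H).Intertwines (spectralMeasure K) T) (ψ : (funOf f H).domain) :
    funOf f K ⟨T ψ, hT.map_mem_domain ψ.2⟩ = T (funOf f H ψ) :=
  hT.integral _ _ _ ψ.2

theorem FBounded.refl (f : C(ℝ, ℝ)) {H : 𝓗 →ₗ.[ℂ] 𝓗} : FBounded f H H := by
  intro l _
  refine ⟨pac H, PVM.isWaveLimit_self l (spectralMeasure H), 0, fun ψ => ?_⟩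
  have h : (pac H - pac H * pac H) (funOf f H ψ) = 0 :=
    sub_eq_zero.mpr ((spectralMeasure H).acProj_acProj _).symm
  change ‖(pac H - pac H * pac H) (funOf f H ψ)‖ ≤ _
  rw [h, norm_zero, zero_mul]

/-- Transitivity of `f`-boundedness. With `Pⱼ = P^ac(Hⱼ)`, `V = W(H₀, H₁)` and `W = W(H₁, H₂)`,
the operator in question splits as
`(V W - P₀ P₂) f(H₂) = P₀ P₁ (W - P₁ P₂) f(H₂) + (V - P₀ P₁) f(H₁) W - P₀ (1 - P₁) f(H₂) P₂`
on the domain of `f(H₂)`, and each of the three terms is bounded there. -/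
theorem FBounded.trans {f : C(ℝ, ℝ)} {H₀ H₁ H₂ : 𝓗 →ₗ.[ℂ] 𝓗} (h₀₁ : FBounded f H₀ H₁)
    (h₁₂ : FBounded f H₁ H₂)
    (hb : IsBoundedOp ((1 - pac H₁).toLinearMap.compPMap (funOf f H₂))) : FBounded f H₀ H₂ := by
  intro l hl
  obtain ⟨V, hV, A, hA⟩ := h₀₁ l hl
  obtain ⟨W, hW, B, hB⟩ := h₁₂ l hl
  obtain ⟨C, hC⟩ := hb
  have hl' := tendsto_add_const_of_mem hl
  have := neBot_of_mem hl
  have hV' : PVM.IsWaveLimit l (spectralMeasure H₀) (spectralMeasure H₁) V := hV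
  have hW' : PVM.IsWaveLimit l (spectralMeasure H₁) (spectralMeasure H₂) W := hW
  have hWi := hW'.intertwines hl'
  have hPi := (spectralMeasure H₂).intertwines_acProj
  refine ⟨V * W, hW'.comp hl' hV', B + |A| * ‖W‖ + |C|, fun ψ => ?_⟩
  have hWψ : W ψ ∈ (funOf f H₁).domain := hWi.map_mem_domain ψ.2
  have hPψ : pac H₂ ψ ∈ (funOf f H₂).domain := hPi.map_mem_domain ψ.2
  have e1 : (V - pac H₀ * pac H₁) (W (funOf f H₂ ψ))
      = (V - pac H₀ * pac H₁) (funOf f H₁ ⟨W ψ, hWψ⟩) :=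
    congrArg _ (funOf_map f hWi ψ).symm
  have e2 : (1 - pac H₁) (pac H₂ (funOf f H₂ ψ))
      = (1 - pac H₁) (funOf f H₂ ⟨pac H₂ ψ, hPψ⟩) :=
    congrArg _ (funOf_map f hPi ψ).symm
  have b0 : ‖(W - pac H₁ * pac H₂) (funOf f H₂ ψ)‖ ≤ B * ‖(ψ : 𝓗)‖ := hB ψ
  have b1 : ‖(V - pac H₀ * pac H₁) (W (funOf f H₂ ψ))‖ ≤ |A| * ‖W‖ * ‖(ψ : 𝓗)‖ := by
    rw [e1, mul_assoc]
    refine (hA ⟨W ψ, hWψ⟩).trans ?_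
    exact mul_le_mul (le_abs_self A) (W.le_opNorm _) (norm_nonneg _) (abs_nonneg _)
  have b2 : ‖(1 - pac H₁) (pac H₂ (funOf f H₂ ψ))‖ ≤ |C| * ‖(ψ : 𝓗)‖ := by
    rw [e2]
    refine (hC ⟨pac H₂ ψ, hPψ⟩).trans ?_
    exact mul_le_mul (le_abs_self C) ((spectralMeasure H₂).norm_acProj_le _) (norm_nonneg _)
      (abs_nonneg _)
  have hpp : ∀ φ : 𝓗, pac H₁ (pac H₁ φ) = pac H₁ φ := (spectralMeasure H₁).acProj_acProj
  change ‖(V * W - pac H₀ * pac H₂) (funOf f H₂ ψ)‖ ≤ _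
  generalize funOf f H₂ ψ = χ at b0 b1 b2 ⊢
  have split : (V * W - pac H₀ * pac H₂) χ
      = pac H₀ (pac H₁ ((W - pac H₁ * pac H₂) χ))
        + (V - pac H₀ * pac H₁) (W χ) - pac H₀ ((1 - pac H₁) (pac H₂ χ)) := by
    simp [hpp]
  rw [split]
  have c0 := (((spectralMeasure H₀).norm_acProj_le _).trans
    ((spectralMeasure H₁).norm_acProj_le ((W - pac H₁ * pac H₂) χ))).trans b0
  have c2 := ((spectralMeasure H₀).norm_acProj_le ((1 - pac H₁) (pac H₂ χ))).trans b2
  calc _ ≤ _ := norm_sub_le _ _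
    _ ≤ _ := add_le_add (norm_add_le _ _) le_rfl
    _ ≤ _ := add_le_add (add_le_add c0 b1) c2
    _ = _ := by ring

theorem PurelyAC.isBoundedOp_one_sub_pac {f : C(ℝ, ℝ)} {H : 𝓗 →ₗ.[ℂ] 𝓗} (h : PurelyAC H)
    (K : 𝓗 →ₗ.[ℂ] 𝓗) : IsBoundedOp ((1 - pac H).toLinearMap.compPMap (funOf f K)) := by
  refine ⟨0, fun ψ => ?_⟩
  have hmem : (funOf f K ψ : 𝓗) ∈ (spectralMeasure H).acSubspace := by
    rw [show (spectralMeasure H).acSubspace = ⊤ from h]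
    exact Submodule.mem_top
  have h0 : (1 - pac H) (funOf f K ψ) = 0 := sub_eq_zero.mpr (PVM.acProj_of_mem hmem).symm
  change ‖(1 - pac H) (funOf f K ψ)‖ ≤ _
  rw [h0, norm_zero, zero_mul]

end Scattering

theorem lemma2p3 {𝓗 : Type*} [NormedAddCommGroup 𝓗] [InnerProductSpace ℂ 𝓗] [CompleteSpace 𝓗]
    (f : C(ℝ, ℝ)) :
    (∀ H₀ H₁ H₂ : 𝓗 →ₗ.[ℂ] 𝓗, IsSelfAdjoint H₀ → IsSelfAdjoint H₁ → IsSelfAdjoint H₂ →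
      Scattering.MutuallyFBounded f H₀ H₁ → Scattering.MutuallyFBounded f H₁ H₂ →
      Scattering.IsBoundedOp
        ((1 - Scattering.pac H₁).toLinearMap.compPMap (Scattering.funOf f H₀)) →
      Scattering.IsBoundedOp
        ((1 - Scattering.pac H₁).toLinearMap.compPMap (Scattering.funOf f H₂)) →
      Scattering.MutuallyFBounded f H₀ H₂) ∧
    Equivalence (fun A B : {H : 𝓗 →ₗ.[ℂ] 𝓗 // IsSelfAdjoint H ∧ Scattering.PurelyAC H} =>
      Scattering.MutuallyFBounded f A.1 B.1) := by
  have main : ∀ {H₀ H₁ H₂ : 𝓗 →ₗ.[ℂ] 𝓗},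
      Scattering.MutuallyFBounded f H₀ H₁ → Scattering.MutuallyFBounded f H₁ H₂ →
      Scattering.IsBoundedOp
        ((1 - Scattering.pac H₁).toLinearMap.compPMap (Scattering.funOf f H₀)) →
      Scattering.IsBoundedOp
        ((1 - Scattering.pac H₁).toLinearMap.compPMap (Scattering.funOf f H₂)) →
      Scattering.MutuallyFBounded f H₀ H₂ :=
    fun h₀₁ h₁₂ hb₀ hb₂ => ⟨h₀₁.1.trans h₁₂.1 hb₂, h₁₂.2.trans h₀₁.2 hb₀⟩
  refine ⟨fun H₀ H₁ H₂ _ _ _ => main, fun A => ?_, fun h => ⟨h.2, h.1⟩, fun {A B C} hAB hBC => ?_⟩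
  · exact ⟨.refl f, .refl f⟩
  · exact main hAB hBC (B.2.2.isBoundedOp_one_sub_pac A.1) (B.2.2.isBoundedOp_one_sub_pac C.1)
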